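/- Let $n\ge 0$ be an integer and let $f(x)=x^TAx+2a^Tx+a_0$ and $g(x)=x^TBx+2b^Tx+b_0$ be non-constant functions on $\mathbb{R}^n$, where $A,B$ are real symmetric $n\times n$ matrices, $a,b\in\mathbb{R}^n$ and $a_0,b_0\in\mathbb{R}$. Call $f$ quadratic if $A\neq 0$ and affine if $A=0$; likewise for $g$ and $B$. For functions $p,q:\mathbb{R}^n\to\mathbb{R}$, say that the level set $\{q=0\}$ separates the level set $\{p=0\}$ if there are non-empty subsets $L^-,L^+$ of $\{p=0\}$ with $\{p=0\}=L^-\cup L^+$ and $q(u)q(v)<0$ for all $u\in L^-$ and $v\in L^+$. Suppose that $\{\gamma f+\delta g=0\}$ separates $\{\alpha f+\beta g=0\}$ for some real numbers $\alpha,\beta,\gamma,\delta$ with $\alpha\delta-\beta\gamma\neq 0$. Then: (a) if both $f$ and $g$ are quadratic, then $\{f=0\}$ separates $\{g=0\}$ and $\{g=0\}$ separates $\{f=0\}$; (b) if one of $f$ and $g$ is affine, then the other one is quadratic, and the level set $\{h=0\}$ of the affine function $h\in\{f,g\}$ separates the level set of the quadratic one. -/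

import Mathlib

open scoped Matrix

/-- The function `x ↦ xᵀ A x + 2 aᵀ x + a₀` on `ℝⁿ`. -/
def quadFun {n : ℕ} (A : Matrix (Fin n) (Fin n) ℝ) (a : Fin n → ℝ) (a₀ : ℝ) :
    (Fin n → ℝ) → ℝ :=
  fun x => x ⬝ᵥ (A *ᵥ x) + 2 * (a ⬝ᵥ x) + a₀

/-- A function is non-constant if it takes two different values. -/
def NonConst {X : Type*} (f : X → ℝ) : Prop :=
  ∃ x y, f x ≠ f y

/-- `SepZero g f`: the level set `{g = 0}` separates the level set `{f = 0}`, that is,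
`{f = 0}` is the union of two non-empty subsets `L⁻`, `L⁺` such that
`g u * g v < 0` for all `u ∈ L⁻` and `v ∈ L⁺`. -/
def SepZero {X : Type*} (g f : X → ℝ) : Prop :=
  ∃ Lm Lp : Set X, Lm.Nonempty ∧ Lp.Nonempty ∧ {x | f x = 0} = Lm ∪ Lp ∧
    ∀ u ∈ Lm, ∀ v ∈ Lp, g u * g v < 0

/-! ### Quadratic functions and their restrictions to lines. -/

section QuadFun

variable {n : ℕ} {A B : Matrix (Fin n) (Fin n) ℝ} {a b : Fin n → ℝ} {a₀ b₀ : ℝ}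

/-! Put F = αf + βg, G = γf + δg, and let w join zeros u, v of F at which G has opposite signs.
Every line in direction w meets {F = 0} in two points with opposite signs of G: as the line moves
away from u, the signs cannot change, so the points cannot merge. Comparing growth, this forces the
quadratic part of G to be c times that of F (`exists_eq_smul_of_separates`).

So h = G - cF is affine, agrees with G on {F = 0}, and takes both signs on every {F + eh = 0}
(`exists_signs_of_affine`). Hence a combination of F and h is separated by any combination not
proportional to it, unless it is a multiple of h (`sepZero_of_pencil`). Among f and g, only an
affine one is a multiple of h. -/

lemma Matrix.IsSymm.dotProduct_mulVec_comm (hA : A.IsSymm) (x y : Fin n → ℝ) :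
    x ⬝ᵥ (A *ᵥ y) = y ⬝ᵥ (A *ᵥ x) := by
  rw [Matrix.dotProduct_mulVec, ← Matrix.mulVec_transpose, hA.eq, dotProduct_comm]

lemma quadFun_add_smul (hA : A.IsSymm) (x w : Fin n → ℝ) (s : ℝ) :
    quadFun A a a₀ (x + s • w) =
      quadFun A a a₀ x + 2 * s * (x ⬝ᵥ (A *ᵥ w) + a ⬝ᵥ w) + s ^ 2 * (w ⬝ᵥ (A *ᵥ w)) := by
  simp only [quadFun, Matrix.mulVec_add, Matrix.mulVec_smul, add_dotProduct, dotProduct_add,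
    smul_dotProduct, dotProduct_smul, smul_eq_mul, hA.dotProduct_mulVec_comm w x]
  ring

lemma quadFun_linear_combination (c d : ℝ) (x : Fin n → ℝ) :
    quadFun (c • A + d • B) (c • a + d • b) (c * a₀ + d * b₀) x =
      c * quadFun A a a₀ x + d * quadFun B b b₀ x := by
  simp only [quadFun, Matrix.add_mulVec, Matrix.smul_mulVec, add_dotProduct, dotProduct_add,
    smul_dotProduct, dotProduct_smul, smul_eq_mul]
  ring

lemma continuous_quadFun : Continuous (quadFun A a a₀) := by
  unfold quadFun
  fun_prop

/-- A symmetric matrix whose quadratic form vanishes is zero. -/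
lemma Matrix.IsSymm.eq_zero_of_dotProduct_mulVec_self (hA : A.IsSymm)
    (h : ∀ x, x ⬝ᵥ (A *ᵥ x) = 0) : A = 0 := by
  have key : ∀ x y, x ⬝ᵥ (A *ᵥ y) = 0 := fun x y => by
    have := h (x + y)
    simp only [Matrix.mulVec_add, add_dotProduct, dotProduct_add, h,
      hA.dotProduct_mulVec_comm y x] at this
    linarith
  ext i j
  simpa using key (Pi.single i 1) (Pi.single j 1)

/-- Two continuous functions that are nonzero wherever `D ≥ 0`, that agree wherever `D = 0`, and
that start with opposite signs keep these signs, and `D` stays positive. -/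
lemma pos_of_signs_differ {D P N : ℝ → ℝ} (hD : Continuous D) (hP : Continuous P)
    (hN : Continuous N) (hne : ∀ t, 0 ≤ D t → P t ≠ 0 ∧ N t ≠ 0)
    (heq : ∀ t, D t = 0 → P t = N t) (hD0 : 0 < D 0) (hP0 : 0 < P 0) (hN0 : N 0 < 0)
    {t : ℝ} (ht : 0 ≤ t) : 0 < D t ∧ 0 < P t ∧ N t < 0 := by
  have signs : ∀ T, 0 ≤ T → (∀ t ∈ Set.Icc 0 T, 0 ≤ D t) → 0 < P T ∧ N T < 0 := by
    intro T hT hDT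
    constructor
    · by_contra! h
      obtain ⟨s, hs, hs0⟩ := intermediate_value_Icc' hT hP.continuousOn ⟨h, hP0.le⟩
      exact (hne s (hDT s hs)).1 hs0
    · by_contra! h
      obtain ⟨s, hs, hs0⟩ := intermediate_value_Icc hT hN.continuousOn ⟨hN0.le, h⟩
      exact (hne s (hDT s hs)).2 hs0
  have hpos : ∀ t, 0 ≤ t → 0 < D t := by
    by_contra! h
    obtain ⟨t₁, ht₁, hDt₁⟩ := h
    have hzero : ∀ s, 0 ≤ s → D s ≤ 0 → ∃ r ∈ Set.Icc 0 s, D r = 0 := fun s hs hDs =>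
      intermediate_value_Icc' hs hD.continuousOn ⟨hDs, hD0.le⟩
    obtain ⟨r, hr, hr0⟩ := hzero t₁ ht₁ hDt₁
    have hcomp : IsCompact (Set.Icc 0 t₁ ∩ D ⁻¹' {0}) :=
      isCompact_Icc.inter_right (isClosed_singleton.preimage hD)
    -- At the first zero T of `D` the signs still differ, yet `P T = N T`.
    obtain ⟨T, ⟨hT, hT0⟩, hmin⟩ := hcomp.exists_isLeast ⟨r, hr, hr0⟩
    have hnn : ∀ t ∈ Set.Icc 0 T, 0 ≤ D t := by
      intro t ht
      by_contra! hneg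
      obtain ⟨r, hr, hr0⟩ := hzero t ht.1 hneg.le
      have hTr : T ≤ r := hmin ⟨⟨hr.1, hr.2.trans (ht.2.trans hT.2)⟩, hr0⟩
      have : t = r := le_antisymm (ht.2.trans hTr) hr.2
      rw [this, hr0] at hneg
      exact lt_irrefl _ hneg
    have h2 := signs T hT.1 hnn
    have h3 := heq T hT0
    linarith [h2.1, h2.2]
  exact ⟨hpos t ht, signs t ht fun s hs => (hpos s hs.1).le⟩

/-- A quartic polynomial bounded above by a quadratic one, on the whole line. -/
lemma eq_zero_of_sq_le_quadratic {p q r x y z : ℝ}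
    (h : ∀ t : ℝ, (p * t ^ 2 + q * t + r) ^ 2 ≤ x * t ^ 2 + y * t + z) : p = 0 := by
  by_contra hp
  -- Divide by t⁴ and let t → ∞: this leaves p² ≤ 0.
  have hlim : Filter.Tendsto (fun t : ℝ => (p + q * t⁻¹ + r * t⁻¹ ^ 2) ^ 2 -
      (x * t⁻¹ ^ 2 + y * t⁻¹ ^ 3 + z * t⁻¹ ^ 4)) Filter.atTop
      (nhds ((p + q * 0 + r * 0 ^ 2) ^ 2 - (x * 0 ^ 2 + y * 0 ^ 3 + z * 0 ^ 4))) := by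
    have hc : Continuous fun s : ℝ => (p + q * s + r * s ^ 2) ^ 2 -
      (x * s ^ 2 + y * s ^ 3 + z * s ^ 4) := by fun_prop
    exact (hc.tendsto 0).comp tendsto_inv_atTop_zero
  have hle := le_of_tendsto hlim (b := 0) (by
    filter_upwards [Filter.eventually_gt_atTop 0] with t ht
    have e : (p + q * t⁻¹ + r * t⁻¹ ^ 2) ^ 2 - (x * t⁻¹ ^ 2 + y * t⁻¹ ^ 3 + z * t⁻¹ ^ 4) =
        ((p * t ^ 2 + q * t + r) ^ 2 - (x * t ^ 2 + y * t + z)) * (t⁻¹) ^ 4 := by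
      field_simp
    rw [e]
    exact mul_nonpos_of_nonpos_of_nonneg (by linarith [h t]) (by positivity))
  have : 0 < p ^ 2 := by positivity
  norm_num at hle
  exact hp hle

/-! ### Separation forces proportional quadratic parts. -/

variable {u v : Fin n → ℝ}

/-- If `{g = 0}` avoids `{f = 0}`, then the quadratic form of `f` does not vanish on a vector
joining two zeros of `f` at which `g` has opposite signs. -/
lemma dotProduct_mulVec_sub_ne_zero (hA : A.IsSymm)
    (hne : ∀ x, quadFun A a a₀ x = 0 → quadFun B b b₀ x ≠ 0)
    (hu : quadFun A a a₀ u = 0) (hv : quadFun A a a₀ v = 0)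
    (hgu : quadFun B b b₀ u < 0) (hgv : 0 < quadFun B b b₀ v) :
    (v - u) ⬝ᵥ (A *ᵥ (v - u)) ≠ 0 := by
  intro h0
  -- Without a quadratic term, f is affine on the line through its zeros u and v, so it vanishes
  -- there, while g has a zero between them.
  have hline := fun s => quadFun_add_smul (a := a) (a₀ := a₀) hA u (v - u) s
  have h1 := hline 1
  rw [one_smul, add_sub_cancel, hu, hv, h0] at h1
  have hm : u ⬝ᵥ (A *ᵥ (v - u)) + a ⬝ᵥ (v - u) = 0 := by linarith
  have hc : Continuous fun s : ℝ => quadFun B b b₀ (u + s • (v - u)) :=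
    continuous_quadFun.comp (by fun_prop)
  obtain ⟨s, -, hs⟩ := intermediate_value_Icc zero_le_one hc.continuousOn
    (show (0 : ℝ) ∈ Set.Icc _ _ by simpa using ⟨hgu.le, hgv.le⟩)
  refine hne _ ?_ hs
  rw [hline, hm, hu, h0]
  ring

/-- An affine function that is positive everywhere is constant. -/
lemma eq_zero_of_forall_pos {k c : ℝ} (h : ∀ t : ℝ, 0 < c + t * k) : k = 0 := by
  by_contra hk
  have := h (-c / k)
  rw [div_mul_cancel₀ _ hk] at this
  linarith

/-- If `{g = 0}` separates `{f = 0}`, then the quadratic part of `g` is a multiple of the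
quadratic part of `f`; here the quadratic form of `f` is negative on a vector that joins the two
parts of `{f = 0}`. -/
lemma exists_eq_smul_of_neg (hA : A.IsSymm) (hB : B.IsSymm)
    (hne : ∀ x, quadFun A a a₀ x = 0 → quadFun B b b₀ x ≠ 0)
    (hu : quadFun A a a₀ u = 0) (hv : quadFun A a a₀ v = 0)
    (hgu : quadFun B b b₀ u < 0) (hgv : 0 < quadFun B b b₀ v)
    (hneg : (v - u) ⬝ᵥ (A *ᵥ (v - u)) < 0) : ∃ c : ℝ, B = c • A := by
  obtain ⟨w, hw⟩ : ∃ w, w = v - u := ⟨_, rfl⟩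
  rw [← hw] at hneg
  obtain ⟨κ, hκ⟩ : ∃ κ, κ = -(w ⬝ᵥ (A *ᵥ w)) := ⟨_, rfl⟩
  have hκ0 : 0 < κ := by linarith
  have hfl : ∀ x s, quadFun A a a₀ (x + s • w) =
      quadFun A a a₀ x + 2 * s * (x ⬝ᵥ (A *ᵥ w) + a ⬝ᵥ w) - s ^ 2 * κ := fun x s => by
    rw [quadFun_add_smul hA, hκ]; ring
  obtain ⟨m, hm⟩ : ∃ m : (Fin n → ℝ) → ℝ, m = fun x => x ⬝ᵥ (A *ᵥ w) + a ⬝ᵥ w := ⟨_, rfl⟩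
  have hfl : ∀ x s, quadFun A a a₀ (x + s • w) =
      quadFun A a a₀ x + 2 * s * m x - s ^ 2 * κ := fun x s => by rw [hfl, hm]
  have hmc : Continuous m := by rw [hm]; fun_prop
  -- A quarter of the discriminant of s ↦ f(x + s w); the roots are (m ± √Δ)/κ.
  obtain ⟨Δ, hΔ⟩ : ∃ Δ : (Fin n → ℝ) → ℝ, Δ = fun x => m x ^ 2 + κ * quadFun A a a₀ x :=
    ⟨_, rfl⟩
  have hΔc : Continuous Δ := by
    rw [hΔ]; exact (hmc.pow 2).add (continuous_const.mul continuous_quadFun)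
  have hroot : ∀ x r, r ^ 2 = Δ x → quadFun A a a₀ (x + ((m x + r) / κ) • w) = 0 := by
    intro x r hr
    rw [hfl]
    rw [hΔ] at hr
    field_simp
    linear_combination (-1) * hr
  have huv : u + (1 : ℝ) • w = v := by rw [hw, one_smul, add_sub_cancel]
  -- On the line through u the roots are s = 0 and s = 1, that is, u and v.
  have hmu : m u = κ / 2 := by
    have := hfl u 1
    rw [huv, hu, hv] at this
    linarith
  have hΔu : Δ u = (κ / 2) ^ 2 := by simp only [hΔ, hmu, hu]; ring
  -- Every line in direction `w` meets both parts of `{f = 0}`.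
  have hsides : ∀ x, 0 < Δ x ∧ 0 < quadFun B b b₀ (x + ((m x + √(Δ x)) / κ) • w) ∧
      quadFun B b b₀ (x + ((m x + -√(Δ x)) / κ) • w) < 0 := by
    intro x
    have hp : Continuous fun t : ℝ => u + t • (x - u) := by fun_prop
    have hs : Continuous fun x => √(Δ x) := Real.continuous_sqrt.comp hΔc
    have hcont : ∀ r : (Fin n → ℝ) → ℝ, Continuous r →
        Continuous fun x => quadFun B b b₀ (x + ((m x + r x) / κ) • w) := fun r hr =>
      continuous_quadFun.comp
        (continuous_id.add ((((hmc.add hr).div_const κ)).smul continuous_const))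
    -- Move the line from u to x. Since `√` is 0 on negative numbers, both root functions are
    -- continuous even where Δ < 0.
    have := pos_of_signs_differ (D := fun t => Δ (u + t • (x - u)))
      (P := fun t => (fun x => quadFun B b b₀ (x + ((m x + √(Δ x)) / κ) • w)) (u + t • (x - u)))
      (N := fun t => (fun x => quadFun B b b₀ (x + ((m x + -√(Δ x)) / κ) • w)) (u + t • (x - u)))
      (hΔc.comp hp)
      ((hcont _ hs).comp hp) ((hcont _ hs.neg).comp hp)
      (fun t ht => ⟨hne _ (hroot _ _ (Real.sq_sqrt ht)),
        hne _ (hroot _ _ (by rw [neg_sq]; exact Real.sq_sqrt ht))⟩)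
      (fun t ht => by simp only [ht, Real.sqrt_zero, neg_zero])
    have hsq : √(Δ u) = κ / 2 := by rw [hΔu, Real.sqrt_sq (by positivity)]
    simp only [zero_smul, add_zero, hsq, hmu, add_halves, div_self hκ0.ne', huv, add_neg_cancel,
      zero_div] at this
    have := this (by rw [hΔu]; positivity) hgv hgu zero_le_one
    simpa using this
  -- This c makes g - c f affine along w, with the values of g at the roots of f.
  obtain ⟨c, hc⟩ : ∃ c, c = (w ⬝ᵥ (B *ᵥ w)) / (w ⬝ᵥ (A *ᵥ w)) := ⟨_, rfl⟩
  have hC : ((1 : ℝ) • B + (-c) • A).IsSymm := (hB.smul 1).add (hA.smul (-c))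
  obtain ⟨C, hCdef⟩ : ∃ C, C = (1 : ℝ) • B + (-c) • A := ⟨_, rfl⟩
  obtain ⟨d, hd⟩ : ∃ d, d = (1 : ℝ) • b + (-c) • a := ⟨_, rfl⟩
  obtain ⟨d₀, hd₀⟩ : ∃ d₀, d₀ = (1 : ℝ) * b₀ + (-c) * a₀ := ⟨_, rfl⟩
  have hCl : ∀ x, quadFun C d d₀ x = quadFun B b b₀ x - c * quadFun A a a₀ x := fun x => by
    rw [hCdef, hd, hd₀, quadFun_linear_combination]; ring
  rw [← hCdef] at hC
  have hCw : w ⬝ᵥ (C *ᵥ w) = 0 := by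
    have : w ⬝ᵥ (A *ᵥ w) ≠ 0 := hneg.ne
    simp only [hCdef, Matrix.add_mulVec, Matrix.smul_mulVec, dotProduct_add, dotProduct_smul,
      smul_eq_mul, hc]
    field_simp
    ring
  obtain ⟨k, hk⟩ : ∃ k : (Fin n → ℝ) → ℝ, k = fun x => x ⬝ᵥ (C *ᵥ w) + d ⬝ᵥ w := ⟨_, rfl⟩
  have hval : ∀ x r, r ^ 2 = Δ x → quadFun B b b₀ (x + ((m x + r) / κ) • w) =
      quadFun C d d₀ x + 2 * ((m x + r) / κ) * k x := by
    intro x r hr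
    have h1 := hCl (x + ((m x + r) / κ) • w)
    rw [hroot x r hr, quadFun_add_smul hC, hCw] at h1
    rw [hk]
    linarith
  have hbounds : ∀ x, 0 < Δ x ∧ 0 < k x ∧
      (κ * quadFun C d d₀ x + 2 * k x * m x) ^ 2 ≤ (2 * k x) ^ 2 * Δ x := by
    intro x
    obtain ⟨h1, h2, h3⟩ := hsides x
    have hsq := Real.sq_sqrt h1.le
    have hspos := Real.sqrt_pos.2 h1
    rw [hval x _ hsq] at h2
    rw [hval x _ (by rw [neg_sq, hsq])] at h3
    have h2' := mul_pos hκ0 h2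
    have h3' := mul_neg_of_pos_of_neg hκ0 h3
    have e2 : κ * (quadFun C d d₀ x + 2 * ((m x + √(Δ x)) / κ) * k x) =
      (κ * quadFun C d d₀ x + 2 * k x * m x) + 2 * k x * √(Δ x) := by field_simp; ring
    have e3 : κ * (quadFun C d d₀ x + 2 * ((m x + -√(Δ x)) / κ) * k x) =
      (κ * quadFun C d d₀ x + 2 * k x * m x) - 2 * k x * √(Δ x) := by field_simp; ring
    rw [e2] at h2'
    rw [e3] at h3'
    refine ⟨h1, ?_, ?_⟩
    · by_contra! hk0
      nlinarith
    · have h4 : (2 * k x) ^ 2 * Δ x = (2 * k x * √(Δ x)) ^ 2 := by rw [mul_pow _ (√(Δ x)), hsq]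
      rw [h4]
      exact sq_le_sq' (by linarith) (by linarith)
  have hkconst : ∀ y, y ⬝ᵥ (C *ᵥ w) = 0 := fun y =>
    eq_zero_of_forall_pos (c := d ⬝ᵥ w) fun t => by
      have := (hbounds (t • y)).2.1
      rw [hk] at this
      simp only [smul_dotProduct, smul_eq_mul] at this
      linarith
  refine ⟨c, ?_⟩
  suffices C = 0 by
    rw [hCdef, one_smul, neg_smul, ← sub_eq_add_neg, sub_eq_zero] at this
    exact this
  refine hC.eq_zero_of_dotProduct_mulVec_self fun y => ?_
  have hkv : ∀ x, k x = d ⬝ᵥ w := fun x => by rw [hk]; simp only [hkconst, zero_add]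
  -- The bound along the line t y: a quartic with leading coefficient (κ yᵀCy)² stays below a
  -- quadratic.
  have hquad : ∀ t : ℝ, (κ * (y ⬝ᵥ (C *ᵥ y)) * t ^ 2 +
      (κ * (2 * d ⬝ᵥ y) + 2 * (d ⬝ᵥ w) * (y ⬝ᵥ (A *ᵥ w))) * t +
      (κ * d₀ + 2 * (d ⬝ᵥ w) * (a ⬝ᵥ w))) ^ 2 ≤
      (2 * (d ⬝ᵥ w)) ^ 2 * ((y ⬝ᵥ (A *ᵥ w)) ^ 2 + κ * (y ⬝ᵥ (A *ᵥ y))) * t ^ 2 +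
      (2 * (d ⬝ᵥ w)) ^ 2 * (2 * (y ⬝ᵥ (A *ᵥ w)) * (a ⬝ᵥ w) + κ * (2 * a ⬝ᵥ y)) * t +
      (2 * (d ⬝ᵥ w)) ^ 2 * ((a ⬝ᵥ w) ^ 2 + κ * a₀) := by
    intro t
    have := (hbounds (t • y)).2.2
    rw [hkv] at this
    simp only [hΔ, hm, quadFun, Matrix.mulVec_smul, smul_dotProduct, dotProduct_smul,
      smul_eq_mul] at this
    convert this using 1 <;> ring
  have := eq_zero_of_sq_le_quadratic hquad
  exact (mul_eq_zero.1 this).resolve_left hκ0.ne'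

/-- If `{g = 0}` separates `{f = 0}`, then the quadratic part of `g` is a multiple of the
quadratic part of `f`. -/
lemma exists_eq_smul_of_separates (hA : A.IsSymm) (hB : B.IsSymm)
    (hne : ∀ x, quadFun A a a₀ x = 0 → quadFun B b b₀ x ≠ 0)
    (hu : quadFun A a a₀ u = 0) (hv : quadFun A a a₀ v = 0)
    (hgu : quadFun B b b₀ u < 0) (hgv : 0 < quadFun B b b₀ v) : ∃ c : ℝ, B = c • A := by
  rcases (dotProduct_mulVec_sub_ne_zero hA hne hu hv hgu hgv).lt_or_gt with h | h
  · exact exists_eq_smul_of_neg hA hB hne hu hv hgu hgv h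
  · have hnegf : ∀ x, quadFun (-A) (-a) (-a₀) x = -quadFun A a a₀ x := fun x => by
      simp only [quadFun, Matrix.neg_mulVec, dotProduct_neg, neg_dotProduct]; ring
    obtain ⟨c, hc⟩ := exists_eq_smul_of_neg (A := -A) (a := -a) (a₀ := -a₀) hA.neg hB
      (fun x hx => hne x (by rw [hnegf] at hx; linarith)) (by rw [hnegf, hu, neg_zero])
      (by rw [hnegf, hv, neg_zero]) hgu hgv
      (by rw [Matrix.neg_mulVec, dotProduct_neg]; linarith)
    exact ⟨-c, by rw [hc, smul_neg, neg_smul]⟩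

end QuadFun

/-! ### The pencil spanned by a quadratic function and an affine one. -/

/-- A quadratic polynomial whose leading and constant coefficients have opposite signs has a
positive root. -/
lemma exists_pos_root {κ c : ℝ} (b : ℝ) (h : 0 < κ * c) :
    ∃ s : ℝ, 0 < s ∧ c + b * s - κ * s ^ 2 = 0 := by
  have hκ : κ ≠ 0 := left_ne_zero_of_mul h.ne'
  have hr := Real.sq_sqrt (show 0 ≤ b ^ 2 + 4 * (κ * c) by positivity)
  have hlt : |b| < √(b ^ 2 + 4 * (κ * c)) := by
    rw [← Real.sqrt_sq_eq_abs]
    exact Real.sqrt_lt_sqrt (sq_nonneg b) (by linarith)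
  obtain ⟨r, hrdef⟩ : ∃ r, r = √(b ^ 2 + 4 * (κ * c)) := ⟨_, rfl⟩
  rw [← hrdef] at hr hlt
  obtain ⟨h1, h2⟩ := abs_lt.1 hlt
  rcases hκ.lt_or_gt with hneg | hpos
  · refine ⟨(b - r) / (2 * κ), div_pos_of_neg_of_neg (by linarith) (by linarith), ?_⟩
    field_simp
    linear_combination (-1) * hr
  · refine ⟨(b + r) / (2 * κ), div_pos (by linarith) (by linarith), ?_⟩
    field_simp
    linear_combination (-1) * hr

/-- If an affine `h` has no common zero with `f` and takes both signs on `{f = 0}`, then it takes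
both signs on `{f + d h = 0}` for every `d`. -/
lemma exists_signs_of_affine {n : ℕ} {A : Matrix (Fin n) (Fin n) ℝ} (hA : A.IsSymm)
    {a d : Fin n → ℝ} {a₀ d₀ : ℝ} {u v : Fin n → ℝ}
    (hq : (v - u) ⬝ᵥ (A *ᵥ (v - u)) ≠ 0)
    (hu : quadFun A a a₀ u = 0) (hv : quadFun A a a₀ v = 0)
    (hgu : quadFun 0 d d₀ u < 0) (hgv : 0 < quadFun 0 d d₀ v) (e : ℝ) :
    (∃ x, quadFun A a a₀ x + e * quadFun 0 d d₀ x = 0 ∧ 0 < quadFun 0 d d₀ x) ∧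
    (∃ x, quadFun A a a₀ x + e * quadFun 0 d d₀ x = 0 ∧ quadFun 0 d d₀ x < 0) := by
  obtain ⟨w, hw⟩ : ∃ w, w = v - u := ⟨_, rfl⟩
  rw [← hw] at hq
  have hfl := fun x s => quadFun_add_smul (a := a) (a₀ := a₀) hA x w s
  have hhl : ∀ x s, quadFun 0 d d₀ (x + s • w) = quadFun 0 d d₀ x + 2 * s * (d ⬝ᵥ w) :=
    fun x s => by
      rw [quadFun_add_smul Matrix.isSymm_zero]
      simp
  have huv : u + (1 : ℝ) • w = v := by rw [hw, one_smul, add_sub_cancel]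
  have h1 := hhl u 1
  have h2 := hfl u 1
  rw [huv] at h1 h2
  rw [hu, hv] at h2
  have hdw : 0 < d ⬝ᵥ w := by linarith
  -- The zero of h on the segment from u to v. There f has the sign opposite to wᵀAw, so f + e h has
  -- roots on both sides of it along w.
  obtain ⟨t, ht⟩ : ∃ t, t = -quadFun 0 d d₀ u / (2 * (d ⬝ᵥ w)) := ⟨_, rfl⟩
  have ht0 : 0 < t := by rw [ht]; exact div_pos (by linarith) (by linarith)
  have ht1 : t < 1 := by rw [ht, div_lt_one (by linarith)]; linarith
  have hx0 : quadFun 0 d d₀ (u + t • w) = 0 := by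
    rw [hhl, ht]
    field_simp
    ring
  have hfx0 : quadFun A a a₀ (u + t • w) = -(w ⬝ᵥ (A *ᵥ w)) * (t * (1 - t)) := by
    rw [hfl, hu]
    linear_combination (-t) * h2
  obtain ⟨x₀, hx₀⟩ : ∃ x₀, x₀ = u + t • w := ⟨_, rfl⟩
  rw [← hx₀] at hx0 hfx0
  have hpos : 0 < -(w ⬝ᵥ (A *ᵥ w)) * quadFun A a a₀ x₀ := by
    rw [hfx0, ← mul_assoc]
    exact mul_pos (mul_self_pos.2 (neg_ne_zero.2 hq)) (mul_pos ht0 (by linarith))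
  obtain ⟨M, hM⟩ : ∃ M, M = x₀ ⬝ᵥ (A *ᵥ w) + a ⬝ᵥ w := ⟨_, rfl⟩
  constructor
  · obtain ⟨s, hs, hroot⟩ := exists_pos_root (2 * M + 2 * e * (d ⬝ᵥ w)) hpos
    refine ⟨x₀ + s • w, ?_, ?_⟩
    · rw [hfl, hhl, hx0, ← hM]
      linear_combination hroot
    · rw [hhl, hx0]
      have := mul_pos hs hdw
      linarith
  · obtain ⟨s, hs, hroot⟩ := exists_pos_root (-(2 * M + 2 * e * (d ⬝ᵥ w))) hpos
    refine ⟨x₀ + (-s) • w, ?_, ?_⟩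
    · rw [hfl, hhl, hx0, ← hM]
      linear_combination hroot
    · rw [hhl, hx0]
      have := mul_pos hs hdw
      linarith

/-- If `h` has no common zero with `f` and takes both signs on `{f + e h = 0}` for every `e`, then
every member of the pencil of `f` and `h` that is not a multiple of `h` is separated by every
member not proportional to it. -/
lemma sepZero_of_pencil {X : Type*} {f h : X → ℝ} (hne : ∀ x, f x = 0 → h x ≠ 0)
    (hsigns : ∀ e : ℝ, (∃ x, f x + e * h x = 0 ∧ 0 < h x) ∧ (∃ x, f x + e * h x = 0 ∧ h x < 0))
    {c₁ c₂ d₁ d₂ : ℝ} (hc : c₁ ≠ 0) (hdet : c₁ * d₂ - c₂ * d₁ ≠ 0) {p r : X → ℝ}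
    (hp : ∀ x, p x = c₁ * f x + c₂ * h x) (hr : ∀ x, r x = d₁ * f x + d₂ * h x) :
    SepZero r p := by
  have hzero : ∀ x, p x = 0 ↔ f x + c₂ / c₁ * h x = 0 := fun x => by
    rw [hp, ← mul_right_inj' hc (b := f x + c₂ / c₁ * h x), mul_zero]
    field_simp
  -- Eliminating f by p = 0 leaves r proportional to h.
  have hval : ∀ x, p x = 0 → c₁ * r x = (c₁ * d₂ - c₂ * d₁) * h x := fun x hx => by
    rw [hp] at hx
    rw [hr]
    linear_combination d₁ * hx
  have hh : ∀ x, p x = 0 → h x ≠ 0 := fun x hx h0 => by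
    refine hne x ?_ h0
    simpa [h0] using (hzero x).1 hx
  obtain ⟨⟨x, hx, hx0⟩, ⟨y, hy, hy0⟩⟩ := hsigns (c₂ / c₁)
  refine ⟨{x | p x = 0 ∧ h x < 0}, {x | p x = 0 ∧ 0 < h x}, ⟨y, (hzero y).2 hy, hy0⟩,
    ⟨x, (hzero x).2 hx, hx0⟩, ?_, ?_⟩
  · ext z
    constructor
    · intro hz
      exact (hh z hz).lt_or_gt.imp (fun h => ⟨hz, h⟩) (fun h => ⟨hz, h⟩)
    · rintro (hz | hz) <;> exact hz.1
  · rintro z ⟨hz, hz0⟩ y ⟨hy, hy0⟩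
    have h1 : c₁ ^ 2 * (r z * r y) = (c₁ * d₂ - c₂ * d₁) ^ 2 * (h z * h y) := by
      linear_combination c₁ * r y * hval z hz + (c₁ * d₂ - c₂ * d₁) * h z * hval y hy
    have h2 : (c₁ * d₂ - c₂ * d₁) ^ 2 * (h z * h y) < 0 :=
      mul_neg_of_pos_of_neg (by positivity) (mul_neg_of_neg_of_pos hz0 hy0)
    rw [← h1] at h2
    exact (pos_iff_neg_of_mul_neg h2).1 (by positivity)

/-- Data extracted from separation: two zeros of `f` with opposite signs of `g`, and no common
zero. -/
lemma SepZero.exists_signs {X : Type*} {f g : X → ℝ} (h : SepZero g f) :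
    (∀ x, f x = 0 → g x ≠ 0) ∧ ∃ u v, f u = 0 ∧ f v = 0 ∧ g u < 0 ∧ 0 < g v := by
  obtain ⟨L, M, ⟨u, hu⟩, ⟨v, hv⟩, hLM, hneg⟩ := h
  have hfu : f u = 0 := by
    have : u ∈ {x | f x = 0} := hLM ▸ Or.inl hu
    exact this
  have hfv : f v = 0 := by
    have : v ∈ {x | f x = 0} := hLM ▸ Or.inr hv
    exact this
  refine ⟨fun x hx h0 => ?_, ?_⟩
  · have hx' : x ∈ L ∪ M := hLM ▸ hx
    rcases hx' with hx' | hx'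
    · simpa [h0] using hneg x hx' v hv
    · simpa [h0] using hneg u hu x hx'
  · rcases mul_neg_iff.1 (hneg u hu v hv) with ⟨h1, h2⟩ | ⟨h1, h2⟩
    · exact ⟨v, u, hfv, hfu, h2, h1⟩
    · exact ⟨u, v, hfu, hfv, h1, h2⟩

/-! ### Application to the pencil of f and g. -/

/-- Here `A = 0` says that the function `f` is affine and `A ≠ 0` that it is quadratic
(of degree exactly two); likewise `B` for the function `g`. -/
theorem corollary2p8 {n : ℕ} (A B : Matrix (Fin n) (Fin n) ℝ) (hA : A.IsSymm) (hB : B.IsSymm)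
    (a b : Fin n → ℝ) (a₀ b₀ : ℝ) (f g : (Fin n → ℝ) → ℝ)
    (hf : f = quadFun A a a₀) (hg : g = quadFun B b b₀)
    (hf_nc : NonConst f) (hg_nc : NonConst g)
    (α β γ δ : ℝ) (hdet : α * δ - β * γ ≠ 0)
    (hsep : SepZero (fun x => γ * f x + δ * g x) (fun x => α * f x + β * g x)) :
    (A ≠ 0 → B ≠ 0 → SepZero f g ∧ SepZero g f) ∧
    (A = 0 → B ≠ 0 ∧ SepZero f g) ∧
    (B = 0 → A ≠ 0 ∧ SepZero g f) := by
  obtain ⟨P, hPdef⟩ : ∃ P, P = α • A + β • B := ⟨_, rfl⟩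
  obtain ⟨Q, hQdef⟩ : ∃ Q, Q = γ • A + δ • B := ⟨_, rfl⟩
  have hP : P.IsSymm := hPdef ▸ (hA.smul α).add (hB.smul β)
  have hQ : Q.IsSymm := hQdef ▸ (hA.smul γ).add (hB.smul δ)
  obtain ⟨p, hp⟩ : ∃ p, p = α • a + β • b := ⟨_, rfl⟩
  obtain ⟨p₀, hp₀⟩ : ∃ p₀, p₀ = α * a₀ + β * b₀ := ⟨_, rfl⟩
  obtain ⟨q, hq⟩ : ∃ q, q = γ • a + δ • b := ⟨_, rfl⟩
  obtain ⟨q₀, hq₀⟩ : ∃ q₀, q₀ = γ * a₀ + δ * b₀ := ⟨_, rfl⟩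
  have hF : ∀ x, quadFun P p p₀ x = α * f x + β * g x := fun x => by
    rw [hPdef, hp, hp₀, quadFun_linear_combination, hf, hg]
  have hG : ∀ x, quadFun Q q q₀ x = γ * f x + δ * g x := fun x => by
    rw [hQdef, hq, hq₀, quadFun_linear_combination, hf, hg]
  simp only [← hF, ← hG] at hsep
  obtain ⟨hne, u, v, hu, hv, hgu, hgv⟩ := hsep.exists_signs
  have hw := dotProduct_mulVec_sub_ne_zero hP hne hu hv hgu hgv
  have hP0 : P ≠ 0 := by
    rintro rfl
    simp at hw
  obtain ⟨c, hc⟩ := exists_eq_smul_of_separates hP hQ hne hu hv hgu hgv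
  obtain ⟨h, hh⟩ : ∃ h, h = quadFun 0 (q - c • p) (q₀ - c * p₀) := ⟨_, rfl⟩
  have hhv : ∀ x, h x = quadFun Q q q₀ x - c * quadFun P p p₀ x := fun x => by
    simp only [hh, hc, quadFun, Matrix.zero_mulVec, Matrix.smul_mulVec, dotProduct_zero,
      sub_dotProduct, smul_dotProduct, dotProduct_smul, smul_eq_mul]
    ring
  have hneh : ∀ x, quadFun P p p₀ x = 0 → h x ≠ 0 := fun x hx => by
    rw [hhv, hx, mul_zero, sub_zero]
    exact hne x hx
  have hsigns := exists_signs_of_affine (d := q - c • p) (d₀ := q₀ - c * p₀) hP hw hu hv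
    (by rwa [← hh, hhv, hu, mul_zero, sub_zero]) (by rwa [← hh, hhv, hv, mul_zero, sub_zero])
  rw [← hh] at hsigns
  obtain ⟨D, hD⟩ : ∃ D, D = α * δ - β * γ := ⟨_, rfl⟩
  rw [← hD] at hdet
  -- Cramer's rule, solving for f and g in terms of F and h.
  have hfc : ∀ x, f x = (δ - β * c) / D * quadFun P p p₀ x + -β / D * h x := fun x => by
    rw [hhv, hF, hG]
    field_simp
    rw [hD]
    ring
  have hgc : ∀ x, g x = (α * c - γ) / D * quadFun P p p₀ x + α / D * h x := fun x => by
    rw [hhv, hF, hG]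
    field_simp
    rw [hD]
    ring
  have hQP : γ • A + δ • B = c • (α • A + β • B) := by rw [← hQdef, ← hPdef, hc]
  have hAP : D • A = (δ - β * c) • P := by
    ext i j
    have := congrFun (congrFun hQP i) j
    simp only [Matrix.add_apply, Matrix.smul_apply, smul_eq_mul, hPdef, hD] at this ⊢
    linear_combination (-β) * this
  have hBP : D • B = (α * c - γ) • P := by
    ext i j
    have := congrFun (congrFun hQP i) j
    simp only [Matrix.add_apply, Matrix.smul_apply, smul_eq_mul, hPdef, hD] at this ⊢
    linear_combination α * this
  -- As P ≠ 0, being quadratic means having a nonzero F-coefficient, which is what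
  -- `sepZero_of_pencil` requires.
  have hA0 : A = 0 ↔ δ - β * c = 0 := by
    rw [← smul_eq_zero_iff_right hdet, hAP, smul_eq_zero_iff_left hP0]
  have hB0 : B = 0 ↔ α * c - γ = 0 := by
    rw [← smul_eq_zero_iff_right hdet, hBP, smul_eq_zero_iff_left hP0]
  have hdet' : (δ - β * c) / D * (α / D) - -β / D * ((α * c - γ) / D) ≠ 0 := by
    have : (δ - β * c) / D * (α / D) - -β / D * ((α * c - γ) / D) = 1 / D := by
      field_simp
      rw [hD]
      ring
    rw [this]
    exact one_div_ne_zero hdet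
  have hgf : A ≠ 0 → SepZero g f := fun hA' =>
    sepZero_of_pencil hneh hsigns (div_ne_zero (mt hA0.2 hA') hdet) hdet' hfc hgc
  have hfg : B ≠ 0 → SepZero f g := fun hB' =>
    sepZero_of_pencil hneh hsigns (div_ne_zero (mt hB0.2 hB') hdet)
      (fun h0 => hdet' (by linear_combination -h0)) hgc hfc
  have hAB : ¬ (A = 0 ∧ B = 0) := by
    rintro ⟨rfl, rfl⟩
    simp [hPdef] at hP0
  exact ⟨fun hA' hB' => ⟨hfg hB', hgf hA'⟩,
    fun h0 => have hB' : B ≠ 0 := fun h => hAB ⟨h0, h⟩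
      ⟨hB', hfg hB'⟩,
    fun h0 => have hA' : A ≠ 0 := fun h => hAB ⟨h, h0⟩
      ⟨hA', hgf hA'⟩⟩
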